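/- Let $p$ be a prime number, let $\chi_1$ be the principal Dirichlet character modulo $p$, and let $\alpha,\beta>0$ be real numbers with $\alpha\beta=\pi^2/p^2$. Let $L(s,\chi_1)$ denote the Dirichlet $L$-function of $\chi_1$, meromorphically continued to $\mathbb{C}$ (with its only pole at $s=1$). For $n\ge 1$ put $a_n=1$ if $\gcd(n,p)=1$ and $a_n=1-p$ if $\gcd(n,p)=p$, and for an integer $m$ put $\sigma_{m,\chi_1}(n)=\sum_{d\mid n}\chi_1(d)\,d^{m}$. Let $B_n$ denote the $n$-th Bernoulli number. Then for every integer $k\neq 0$ the two infinite series below converge absolutely, and $$(4\alpha)^{-k}\left(\frac{p-1}{2}L(2k+1,\chi_1)-\sum_{n=1}^{\infty}a_n\,\sigma_{-2k-1,\chi_1}(n)\,e^{-2n\alpha}\right)-(-4\beta)^{-k}\left(\frac{p-1}{2}L(2k+1,\chi_1)-\sum_{n=1}^{\infty}a_n\,\sigma_{-2k-1,\chi_1}(n)\,e^{-2n\beta}\right)$$ $$=\sum_{j=1}^{k}(-1)^{j-1}(p^{2j}-1)(p^{2k+2-2j}-1)\frac{B_{2j}}{(2j)!}\frac{B_{2k+2-2j}}{(2k+2-2j)!}\,\alpha^{k+1-j}\beta^{j},$$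 where the sum on the right-hand side is empty (equal to $0$) if $k<0$. -/

import Mathlib

noncomputable section

/-- The coefficient `a_n` attached to `p`: it is `1` if `n` is coprime to `p`, and `1 - p` if not
(for `p` prime, the latter means `gcd(n, p) = p`). -/
def ramaCoeff (p n : ℕ) : ℂ := if Nat.gcd n p = 1 then 1 else 1 - (p : ℂ)

/-- The character analogue of the divisor function,
`σ_{m,χ}(n) = ∑_{d ∣ n} χ(d) d ^ m`, for an integer `m`. -/
def sigmaChar {N : ℕ} (m : ℤ) (χ : DirichletCharacter ℂ N) (n : ℕ) : ℂ :=
  ∑ d ∈ n.divisors, χ (d : ZMod N) * (d : ℂ) ^ m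

/-- The `n`-th term `a_n σ_{-2k-1,χ₁}(n) e^{-2nx}`, with `χ₁` the principal character mod `p`. -/
def ramaTerm (p : ℕ) (k : ℤ) (x : ℝ) (n : ℕ) : ℂ :=
  ramaCoeff p n * sigmaChar (-2 * k - 1) (1 : DirichletCharacter ℂ p) n *
    (Real.exp (-2 * (n : ℝ) * x) : ℂ)

end

/-! ### Coprimality weights and the underlying double series. -/

section

open Finset

/-! Write χ(n) for the indicator of p ∤ n. Since a_{ed} χ(d) = a_e χ(d), each series is the double
sum of a_e χ(d) d^{-2k-1} e^{-2edx} (`hasSum_ramaTerm`). The sign of k decides how it is treated.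

For k = -m < 0 the identity is modularity. Let E(x) be the level-one Eisenstein series of weight 2m
at ix/π. Sieving by p (`tsum_lambertTerm_eq_sigmaSeries`) makes the bracket at x a constant times
E(x) - (p^{2m-1} + p) E(px) + p^{2m} E(p²x); the constant terms supply the L-value. As αβ = π²/p², z
↦ -1/z pairs p^j α with p^{2-j} β, and `sigmaSeries_transform` matches the two brackets.

For k = m > 0, summing over e first gives a difference of hyperbolic cotangents. Its partial
fractions turn the bracket into ∑ χ(d) χ(n) d^{-2m} / (d²α + n²β)
(`bracket_eq_tsum_partialFractionTerm`). After swapping d and n in the β-series, the difference of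
the summands is a finite geometric sum (`partialFraction_identity`), so it separates into products
of even zeta values, that is, of Bernoulli numbers. -/

/-- The indicator function of the natural numbers not divisible by `p`. -/
def coprimeInd (p n : ℕ) : ℂ := if p ∣ n then 0 else 1

lemma trivChar_natCast (p : ℕ) [Fact p.Prime] (n : ℕ) :
    (1 : DirichletCharacter ℂ p) (n : ZMod p) = coprimeInd p n := by
  unfold coprimeInd
  split_ifs with h
  · rw [(ZMod.natCast_eq_zero_iff n p).mpr h]
    exact MulChar.map_zero _
  · apply MulChar.one_apply
    rw [isUnit_iff_ne_zero, Ne, ZMod.natCast_eq_zero_iff]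
    exact h

lemma ramaCoeff_eq (p : ℕ) [hp : Fact p.Prime] (n : ℕ) :
    ramaCoeff p n = 1 - p + p * coprimeInd p n := by
  have h : Nat.gcd n p = 1 ↔ ¬ p ∣ n := by
    rw [← Nat.coprime_iff_gcd_eq_one, Nat.coprime_comm, hp.out.coprime_iff_not_dvd]
  by_cases hd : p ∣ n <;> simp [ramaCoeff, coprimeInd, h, hd]

lemma coprimeInd_mul (p : ℕ) [hp : Fact p.Prime] (m n : ℕ) :
    coprimeInd p (m * n) = coprimeInd p m * coprimeInd p n := by
  unfold coprimeInd
  by_cases hm : p ∣ m <;> by_cases hn : p ∣ n <;> simp [hp.out.dvd_mul, hm, hn]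

/-- When p ∤ d, p divides ed exactly when it divides e. This lets a_n depend on the cofactor e
alone, which separates the variables. -/
lemma ramaCoeff_mul_coprimeInd (p : ℕ) [hp : Fact p.Prime] (m n : ℕ) :
    ramaCoeff p (m * n) * coprimeInd p n = ramaCoeff p m * coprimeInd p n := by
  rw [ramaCoeff_eq, ramaCoeff_eq, coprimeInd_mul]
  unfold coprimeInd
  split_ifs <;> simp

lemma norm_coprimeInd_le (p n : ℕ) : ‖coprimeInd p n‖ ≤ 1 := by
  unfold coprimeInd
  split_ifs <;> simp

lemma norm_ramaCoeff_le (p n : ℕ) : ‖ramaCoeff p n‖ ≤ 1 + p := by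
  unfold ramaCoeff
  split_ifs
  · simp
  · exact (norm_sub_le _ _).trans (by simp)

lemma hasSum_coprimeInd_mul {p : ℕ} (hp : 0 < p) {f : ℕ → ℂ} (hf : Summable fun n : ℕ+ ↦ f n) :
    HasSum (fun n : ℕ+ ↦ coprimeInd p n * f n)
      (∑' n : ℕ+, f n - ∑' n : ℕ+, f (p * n)) := by
  lift p to ℕ+ using hp
  have hi : Function.Injective fun n : ℕ+ ↦ p * n := mul_right_injective p
  have h1 : HasSum (fun n : ℕ+ ↦ if (p : ℕ) ∣ n then f n else 0) (∑' n : ℕ+, f (p * n)) := by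
    rw [← hi.hasSum_iff]
    · have := (hf.comp_injective hi).hasSum
      simpa [Function.comp_def] using this
    · intro n hn
      rw [if_neg]
      rintro ⟨m, hm⟩
      have hm0 : 0 < m := by
        rcases Nat.eq_zero_or_pos m with rfl | h
        · simp at hm
        · exact h
      exact hn ⟨⟨m, hm0⟩, PNat.coe_injective hm.symm⟩
  refine (hf.hasSum.sub h1).congr_fun ?_
  intro n
  unfold coprimeInd
  split_ifs <;> simp

lemma hasSum_ramaCoeff_mul {p : ℕ} [hp : Fact p.Prime] {f : ℕ → ℂ}
    (hf : Summable fun n : ℕ+ ↦ f n) :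
    HasSum (fun n : ℕ+ ↦ ramaCoeff p n * f n)
      (∑' n : ℕ+, f n - p * ∑' n : ℕ+, f (p * n)) := by
  have := (hf.hasSum.mul_left (1 - p : ℂ)).add
    ((hasSum_coprimeInd_mul hp.out.pos hf).mul_left (p : ℂ))
  convert! this using 1
  · ext n
    rw [ramaCoeff_eq]
    ring
  · ring

lemma hasSum_sum_divisorsAntidiagonal {F : ℕ → ℕ → ℂ}
    (hF : Summable fun c : ℕ+ × ℕ+ ↦ F c.1 c.2) :
    HasSum (fun n : ℕ+ ↦ ∑ x ∈ (n : ℕ).divisorsAntidiagonal, F x.1 x.2)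
      (∑' c : ℕ+ × ℕ+, F c.1 c.2) := by
  have h := (sigmaAntidiagonalEquivProd.hasSum_iff.mpr hF.hasSum).sigma
    (fun n ↦ hasSum_fintype _)
  refine h.congr_fun fun n ↦ ?_
  simp only [Function.comp_apply, sigmaAntidiagonalEquivProd, divisorsAntidiagonalFactors,
    Equiv.coe_fn_mk, PNat.mk_coe, univ_eq_attach]
  exact ((n : ℕ).divisorsAntidiagonal.sum_attach fun x ↦ F x.1 x.2).symm

/-- The terms of the double series underlying `∑ ramaTerm`. -/
noncomputable def lambertTerm (p : ℕ) (m : ℤ) (r : ℂ) (e d : ℕ) : ℂ :=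
  ramaCoeff p e * (coprimeInd p d * ((d : ℂ) ^ m * r ^ (e * d)))

lemma ramaTerm_eq_sum (p : ℕ) [Fact p.Prime] (k : ℤ) (x : ℝ) (n : ℕ) :
    ramaTerm p k x n = ∑ y ∈ n.divisorsAntidiagonal,
      lambertTerm p (-2 * k - 1) (Real.exp (-2 * x) : ℂ) y.1 y.2 := by
  rw [ramaTerm, sigmaChar, Nat.sum_divisorsAntidiagonal', mul_sum, sum_mul]
  refine sum_congr rfl fun d hd ↦ ?_
  simp only [lambertTerm]
  have h : n / d * d = n := Nat.div_mul_cancel (Nat.dvd_of_mem_divisors hd)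
  rw [trivChar_natCast, h]
  have h2 : (Real.exp (-2 * n * x) : ℂ) = (Real.exp (-2 * x) : ℂ) ^ n := by
    rw [← Complex.ofReal_pow, ← Real.exp_nat_mul]
    ring_nf
  rw [h2]
  have := ramaCoeff_mul_coprimeInd p (n / d) d
  rw [h] at this
  linear_combination (d : ℂ) ^ (-2 * k - 1) * (Real.exp (-2 * x) : ℂ) ^ n * this

/-- As d ≥ 1, replacing m by |m| only enlarges the terms, so one bound serves both signs of k. -/
lemma summable_lambertTerm (p : ℕ) (m : ℤ) {r : ℂ} (hr : ‖r‖ < 1) :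
    Summable fun c : ℕ+ × ℕ+ ↦ lambertTerm p m r c.1 c.2 := by
  have h := ((summable_prod_mul_pow m.natAbs hr).norm).mul_left (1 + p : ℝ)
  refine Summable.of_norm_bounded h fun c ↦ ?_
  rw [lambertTerm, norm_mul, norm_mul, norm_mul, norm_mul]
  have hd : ‖((c.2 : ℕ) : ℂ) ^ m‖ ≤ ‖((c.2 : ℕ) : ℂ) ^ m.natAbs‖ := by
    rw [norm_zpow, norm_pow, Complex.norm_natCast, ← zpow_natCast]
    exact zpow_le_zpow_right₀ (by exact_mod_cast c.2.pos) (by omega)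
  have h1 := norm_coprimeInd_le p c.2
  have h2 := norm_ramaCoeff_le p c.1
  calc _ ≤ (1 + p : ℝ) * (1 * (‖((c.2 : ℕ) : ℂ) ^ m.natAbs‖ * ‖r ^ ((c.1 : ℕ) * (c.2 : ℕ))‖)) := by
        gcongr
    _ = _ := by rw [one_mul]

lemma norm_exp_neg_two_mul_lt_one {x : ℝ} (hx : 0 < x) : ‖(Real.exp (-2 * x) : ℂ)‖ < 1 := by
  rw [Complex.norm_real, Real.norm_of_nonneg (Real.exp_nonneg _), Real.exp_lt_one_iff]
  linarith

lemma hasSum_ramaTerm (p : ℕ) [Fact p.Prime] (k : ℤ) {x : ℝ} (hx : 0 < x) :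
    HasSum (fun n : ℕ+ ↦ ramaTerm p k x n)
      (∑' c : ℕ+ × ℕ+, lambertTerm p (-2 * k - 1) (Real.exp (-2 * x) : ℂ) c.1 c.2) := by
  simp_rw [ramaTerm_eq_sum]
  exact hasSum_sum_divisorsAntidiagonal
    (summable_lambertTerm p _ (norm_exp_neg_two_mul_lt_one hx))

lemma LFunction_trivChar_prime (p : ℕ) [hp : Fact p.Prime] {s : ℂ} (hs : s ≠ 1) :
    DirichletCharacter.LFunction (1 : DirichletCharacter ℂ p) s =
      (1 - (p : ℂ) ^ (-s)) * riemannZeta s := by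
  have := DirichletCharacter.LFunctionTrivChar_eq_mul_riemannZeta (N := p) hs
  rwa [hp.out.primeFactors, prod_singleton] at this

/-! ### Level-one Eisenstein series and their transformation under z ↦ -1/z. -/

section LevelOne

open UpperHalfPlane ModularGroup EisensteinSeries ArithmeticFunction Matrix
open scoped Real Nat MatrixGroups ArithmeticFunction.sigma

/-- The `q`-expansion of the (unnormalised) Eisenstein series of weight `w` and level one. -/
noncomputable def eisensteinQ (w : ℕ) (z : ℍ) : ℂ :=
  2 * riemannZeta w + 2 * ((-2 * π * Complex.I) ^ w / (w - 1)!) *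
    ∑' n : ℕ+, σ (w - 1) n * Complex.exp (2 * π * Complex.I * z) ^ (n : ℕ)

/-- S permutes the index lattice ℤ², so the sum is only reindexed. -/
lemma tsum_eisSummand_S_smul (k : ℤ) (z : ℍ) :
    ∑' v, eisSummand k v (S • z) = (z : ℂ) ^ k * ∑' v, eisSummand k v z := by
  have h1 : ((S : SL(2, ℤ)) : Matrix (Fin 2) (Fin 2) ℤ) * ((S⁻¹ : SL(2, ℤ)) : Matrix (Fin 2) (Fin 2) ℤ) = 1 :=
    congrArg Subtype.val (mul_inv_cancel S)
  have h2 : ((S⁻¹ : SL(2, ℤ)) : Matrix (Fin 2) (Fin 2) ℤ) * ((S : SL(2, ℤ)) : Matrix (Fin 2) (Fin 2) ℤ) = 1 :=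
    congrArg Subtype.val (inv_mul_cancel S)
  let e : (Fin 2 → ℤ) ≃ (Fin 2 → ℤ) :=
    { toFun := fun v ↦ v ᵥ* ((S : SL(2, ℤ)) : Matrix (Fin 2) (Fin 2) ℤ)
      invFun := fun v ↦ v ᵥ* ((S⁻¹ : SL(2, ℤ)) : Matrix (Fin 2) (Fin 2) ℤ)
      left_inv := fun v ↦ by
        change v ᵥ* ((S : SL(2, ℤ)) : Matrix (Fin 2) (Fin 2) ℤ) ᵥ* ((S⁻¹ : SL(2, ℤ)) : Matrix (Fin 2) (Fin 2) ℤ) = v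
        rw [vecMul_vecMul, h1, vecMul_one]
      right_inv := fun v ↦ by
        change v ᵥ* ((S⁻¹ : SL(2, ℤ)) : Matrix (Fin 2) (Fin 2) ℤ) ᵥ* ((S : SL(2, ℤ)) : Matrix (Fin 2) (Fin 2) ℤ) = v
        rw [vecMul_vecMul, h2, vecMul_one] }
  rw [← e.tsum_eq (fun v ↦ eisSummand k v z), ← tsum_mul_left]
  refine tsum_congr fun v ↦ ?_
  rw [eisSummand_SL2_apply, denom_S]
  rfl

/-- The constant c absorbs the quasi-modularity of weight 2 and is 0 in higher weight. Its value is
irrelevant, because it cancels in the sieved combination. -/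
lemma eisensteinQ_S_smul {w : ℕ} (hw : 2 ≤ w) (hw2 : Even w) :
    ∃ c : ℂ, ∀ z : ℍ, eisensteinQ w (S • z) = (z : ℂ) ^ w * eisensteinQ w z + c * z := by
  rcases hw.eq_or_lt with rfl | hw3
  · refine ⟨-2 * π * Complex.I, fun z ↦ ?_⟩
    have h (z : ℍ) : eisensteinQ 2 z = G2 z := by
      rw [G2_eq_tsum_cexp, eisensteinQ, mul_pow, Complex.I_sq]
      simp
      ring
    have hz : (z : ℂ) ≠ 0 := ne_zero z
    rw [h, h, G2_S_transform z]
    field_simp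
    ring
  · refine ⟨0, fun z ↦ ?_⟩
    have h (z : ℍ) : eisensteinQ w z = ∑' v, eisSummand w v z :=
      (tsum_eisSummand_eq_tsum_sigma_mul_cexp_pow hw3 hw2 z).symm
    rw [h, h, tsum_eisSummand_S_smul, zpow_natCast, zero_mul, add_zero]

/-- The Lambert series of the divisor function `σ_m` at `e^{-2x}`. -/
noncomputable def sigmaSeries (m : ℕ) (x : ℝ) : ℂ :=
  ∑' n : ℕ+, σ m n * (Real.exp (-2 * x) : ℂ) ^ (n : ℕ)

lemma sigmaSeries_transform {w : ℕ} (hw : 2 ≤ w) (hw2 : Even w) :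
    ∃ c : ℂ, ∀ x y : ℝ, 0 < x → 0 < y → x * y = π ^ 2 →
      2 * riemannZeta w + 2 * ((-2 * π * Complex.I) ^ w / (w - 1)!) * sigmaSeries (w - 1) y =
        (Complex.I * x / π) ^ w * (2 * riemannZeta w +
          2 * ((-2 * π * Complex.I) ^ w / (w - 1)!) * sigmaSeries (w - 1) x) + c * x := by
  obtain ⟨c, hc⟩ := eisensteinQ_S_smul hw hw2
  refine ⟨c * (Complex.I / π), fun x y hx hy hxy ↦ ?_⟩
  have hpi : (π : ℂ) ≠ 0 := by exact_mod_cast Real.pi_ne_zero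
  have him (x : ℝ) (hx : 0 < x) : 0 < (Complex.I * (x / π : ℝ)).im := by
    rw [Complex.I_mul_im, Complex.ofReal_re]
    exact div_pos hx Real.pi_pos
  have hq (x : ℝ) (hx : 0 < x) (z : ℍ) (hz : (z : ℂ) = Complex.I * (x / π : ℝ)) :
      eisensteinQ w z = 2 * riemannZeta w +
        2 * ((-2 * π * Complex.I) ^ w / (w - 1)!) * sigmaSeries (w - 1) x := by
    rw [eisensteinQ, sigmaSeries, hz]
    have : 2 * π * Complex.I * (Complex.I * (x / π : ℝ)) = ((-2 * x : ℝ) : ℂ) := by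
      push_cast
      field_simp
      rw [Complex.I_sq]
      ring
    rw [this, Complex.ofReal_exp]
  let z : ℍ := ⟨Complex.I * (x / π : ℝ), him x hx⟩
  have hz : (z : ℂ) = Complex.I * (x / π : ℝ) := rfl
  have hS : ((S • z : ℍ) : ℂ) = Complex.I * (y / π : ℝ) := by
    rw [modular_S_smul, coe_mk, hz]
    have hxy' : (x : ℂ) * y = π ^ 2 := by exact_mod_cast hxy
    push_cast
    apply inv_eq_of_mul_eq_one_right
    field_simp
    rw [Complex.I_sq]
    linear_combination hxy'
  have := hc z
  rw [hq y hy _ hS, hq x hx _ hz, hz] at this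
  rw [this]
  push_cast
  ring

/-- The functional equation puts the constant term in the same normalisation as the q-series,
exposing the value at 1 - w. -/
lemma two_mul_riemannZeta_even {w : ℕ} (hw : 2 ≤ w) (hw2 : Even w) :
    2 * riemannZeta w =
      2 * ((-2 * π * Complex.I) ^ w / (w - 1)!) * (riemannZeta (1 - w) / 2) := by
  have hpi : (2 * π : ℂ) ≠ 0 := by simp [Real.pi_ne_zero]
  rw [riemannZeta_one_sub (fun n h ↦ ?_) (by norm_cast; omega)]
  · have hG : Complex.Gamma w = (w - 1)! := by
      obtain ⟨v, rfl⟩ : ∃ v, w = v + 1 := ⟨w - 1, by omega⟩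
      push_cast
      rw [Complex.Gamma_nat_eq_factorial]
    have hf : ((w - 1)! : ℂ) ≠ 0 := by exact_mod_cast Nat.factorial_ne_zero _
    obtain ⟨m, rfl⟩ := hw2
    have hcos : Complex.cos (π * (m + m : ℕ) / 2) = (-1) ^ m := by
      have := Real.cos_nat_mul_pi m
      rw [show (π * (m + m : ℕ) / 2 : ℂ) = (m * π : ℝ) by push_cast; ring, ← Complex.ofReal_cos,
        this]
      push_cast
      rfl
    have hI : (-2 * π * Complex.I) ^ (m + m) = (2 * π : ℂ) ^ (m + m) * (-1) ^ m := by
      rw [show (-2 * π * Complex.I : ℂ) = (2 * π) * (-Complex.I) by ring, mul_pow, ← two_mul,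
        pow_mul (-Complex.I), neg_sq, Complex.I_sq]
    rw [hG, hcos, hI, Complex.cpow_neg, Complex.cpow_natCast]
    have h1 : ((-1 : ℂ) ^ m) * (-1) ^ m = 1 := by rw [← mul_pow]; simp
    field_simp
    linear_combination (-riemannZeta (m + m : ℕ)) * h1
  · have : ((w + n : ℕ) : ℂ) = 0 := by push_cast; rw [h]; ring
    norm_cast at this
    omega

/-- With V the dilation x ↦ px, the weight a_e contributes 1 - pV and the condition p ∤ d
contributes 1 - p^m V; the right side is their product. -/
lemma tsum_lambertTerm_eq_sigmaSeries (p : ℕ) [hp : Fact p.Prime] (m : ℕ) {x : ℝ} (hx : 0 < x) :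
    ∑' c : ℕ+ × ℕ+, lambertTerm p m (Real.exp (-2 * x) : ℂ) c.1 c.2 =
      sigmaSeries m x - (p ^ m + p) * sigmaSeries m (p * x) +
        p ^ (m + 1) * sigmaSeries m (p ^ 2 * x) := by
  have hp0 : 0 < p := hp.out.pos
  set r : ℂ := (Real.exp (-2 * x) : ℂ)
  have hr : ‖r‖ < 1 := norm_exp_neg_two_mul_lt_one hx
  let u : ℕ → ℂ := fun e ↦ ∑' d : ℕ+, (d : ℂ) ^ m * r ^ (e * d)
  have hrj (j : ℕ) (hj : 0 < j) : ‖r ^ j‖ < 1 := by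
    rw [norm_pow]
    exact pow_lt_one₀ (norm_nonneg _) hr hj.ne'
  have hu (j : ℕ) (hj : 0 < j) : HasSum (fun e : ℕ+ ↦ u (j * e)) (sigmaSeries m (j * x)) := by
    have h := (summable_prod_mul_pow m (hrj j hj)).prod.hasSum
    rw [tsum_prod_pow_eq_tsum_sigma m (hrj j hj)] at h
    convert! h using 1
    · ext e
      refine tsum_congr fun d ↦ ?_
      rw [← pow_mul, mul_assoc]
    · refine tsum_congr fun n ↦ ?_
      congr 2
      rw [← Complex.ofReal_pow, ← Real.exp_nat_mul]
      ring_nf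
  have hin (e : ℕ+) : ∑' d : ℕ+, lambertTerm p m r e d =
      ramaCoeff p e * (u e - p ^ m * u (p * e)) := by
    simp only [lambertTerm, zpow_natCast]
    rw [tsum_mul_left, (hasSum_coprimeInd_mul hp0 (f := fun d ↦ (d : ℂ) ^ m * r ^ ((e : ℕ) * d))
      ?_).tsum_eq, ← tsum_mul_left]
    · congr 2
      refine tsum_congr fun d ↦ ?_
      push_cast
      rw [mul_pow, mul_assoc]
      ring_nf
    · exact (summable_prod_mul_pow m hr).prod_factor e
  rw [(summable_lambertTerm p m hr).tsum_prod]
  simp_rw [hin]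
  have h1 : HasSum (fun e : ℕ+ ↦ u e) (sigmaSeries m x) := by simpa using hu 1 one_pos
  have hp1 := hu p hp0
  have hp2 : HasSum (fun e : ℕ+ ↦ u (p * (p * e))) (sigmaSeries m (p ^ 2 * x)) := by
    simpa [mul_assoc, sq] using hu (p * p) (by positivity)
  have hA := h1.sub (hp1.mul_left ((p : ℂ) ^ m))
  have hB := hp1.sub (hp2.mul_left ((p : ℂ) ^ m))
  rw [(hasSum_ramaCoeff_mul (p := p) (f := fun e ↦ u e - p ^ m * u (p * e)) hA.summable).tsum_eq,
    hA.tsum_eq, hB.tsum_eq]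
  ring

end LevelOne

/-! ### Negative k: modularity. -/

section NegativeIndex

open scoped Real Nat

lemma bracket_transform_neg (p : ℕ) [hp : Fact p.Prime] {α β : ℝ} (hα : 0 < α) (hβ : 0 < β)
    (hαβ : α * β = π ^ 2 / (p : ℝ) ^ 2) {m : ℕ} (hm : 0 < m) :
    (4 * (α : ℂ)) ^ m *
        (((p : ℂ) - 1) / 2 *
            DirichletCharacter.LFunction (1 : DirichletCharacter ℂ p) (1 - (2 * m : ℕ))
          - ∑' c : ℕ+ × ℕ+, lambertTerm p (2 * m - 1 : ℕ) (Real.exp (-2 * α) : ℂ) c.1 c.2) =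
      (-4 * (β : ℂ)) ^ m *
        (((p : ℂ) - 1) / 2 *
            DirichletCharacter.LFunction (1 : DirichletCharacter ℂ p) (1 - (2 * m : ℕ))
          - ∑' c : ℕ+ × ℕ+, lambertTerm p (2 * m - 1 : ℕ) (Real.exp (-2 * β) : ℂ) c.1 c.2) := by
  have hp0 : (0 : ℝ) < p := by exact_mod_cast hp.out.pos
  have hpi : (π : ℂ) ≠ 0 := by exact_mod_cast Real.pi_ne_zero
  have hw : 2 ≤ 2 * m := by omega
  have hw2 : Even (2 * m) := even_two_mul m
  obtain ⟨c, hc⟩ := sigmaSeries_transform hw hw2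
  have hxy : α * β * (p : ℝ) ^ 2 = π ^ 2 := by rw [hαβ]; field_simp
  have e1 := hc (p ^ 2 * α) β (by positivity) hβ (by linear_combination hxy)
  have e2 := hc (p * α) (p * β) (by positivity) (by positivity) (by linear_combination hxy)
  have e3 := hc α (p ^ 2 * β) hα (by positivity) (by linear_combination hxy)
  rw [two_mul_riemannZeta_even hw hw2] at e1 e2 e3
  rw [LFunction_trivChar_prime p (by
    rw [Ne, sub_eq_self, Nat.cast_eq_zero]; omega), neg_sub,
    tsum_lambertTerm_eq_sigmaSeries p _ hα, tsum_lambertTerm_eq_sigmaSeries p _ hβ]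
  have hps : (p : ℂ) ^ (((2 * m : ℕ) : ℂ) - 1) = (p : ℂ) ^ (2 * m - 1) := by
    rw [← Complex.cpow_natCast, Nat.cast_sub (by omega), Nat.cast_one]
  rw [hps]
  have hsucc : (p : ℂ) ^ (2 * m - 1 + 1) = p * (p : ℂ) ^ (2 * m - 1) := pow_succ' _ _
  have hpw : (p : ℂ) ^ (2 * m) = p * (p : ℂ) ^ (2 * m - 1) := by
    rw [← hsucc]; congr 1; omega
  set K : ℂ := 2 * ((-2 * π * Complex.I) ^ (2 * m) / (2 * m - 1)!) with hK
  have hK0 : K ≠ 0 := by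
    rw [hK]
    have : ((2 * m - 1)! : ℂ) ≠ 0 := by exact_mod_cast Nat.factorial_ne_zero _
    simp [hpi, this]
  -- The automorphy factor at the middle point pα accounts exactly for the ratio of the two
  -- prefactors.
  have hαβ' : (-4 * β : ℂ) ^ m * (Complex.I * (p * α) / π) ^ (2 * m) = (4 * α) ^ m := by
    rw [pow_mul, ← mul_pow]
    congr 1
    have hxy' : (α : ℂ) * β * (p : ℂ) ^ 2 = π ^ 2 := by exact_mod_cast hxy
    field_simp
    rw [Complex.I_sq]
    linear_combination (α : ℂ) * hxy'
  rw [← hαβ', hsucc]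
  generalize riemannZeta (1 - (2 * m : ℕ)) = Z at *
  push_cast at e1 e2 e3
  have f1 : (Complex.I * (p ^ 2 * α) / π) ^ (2 * m) =
      p * (p : ℂ) ^ (2 * m - 1) * (Complex.I * (p * α) / π) ^ (2 * m) := by
    rw [← hpw, ← mul_pow]; congr 1; ring
  have f3 : p * (p : ℂ) ^ (2 * m - 1) * (Complex.I * α / π) ^ (2 * m) =
      (Complex.I * (p * α) / π) ^ (2 * m) := by
    rw [← hpw, ← mul_pow]; congr 1; ring
  rw [f1] at e1
  generalize (p : ℂ) ^ (2 * m - 1) = P at *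
  generalize (Complex.I * α / π) ^ (2 * m) = A at *
  generalize (Complex.I * (p * α) / π) ^ (2 * m) = A' at *
  apply mul_left_cancel₀ hK0
  -- The anomalous terms add up to cα(p² - (P + p)p + pP) = 0.
  linear_combination (-4 * β : ℂ) ^ m * (e1 - (P + p) * e2 + p * P * e3 +
    f3 * (K * (Z / 2) + K * sigmaSeries (2 * m - 1) α))

end NegativeIndex

/-! ### Positive k: partial fractions and even zeta values. -/

section PositiveIndex

open scoped Real Nat

lemma Summable.comp_pnat_coe {E : Type*} [NormedAddCommGroup E] [CompleteSpace E] {f : ℕ → E}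
    (hf : Summable f) : Summable fun n : ℕ+ ↦ f n :=
  hf.comp_injective (i := ((↑) : ℕ+ → ℕ)) PNat.coe_injective

lemma summable_pnat_one_div_sq : Summable fun n : ℕ+ ↦ 1 / (n : ℝ) ^ 2 :=
  (Real.summable_one_div_nat_pow.mpr one_lt_two).comp_pnat_coe

lemma summable_exp_pow {z : ℝ} (hz : 0 < z) :
    Summable fun n : ℕ ↦ (Real.exp (-2 * z) : ℂ) ^ n :=
  summable_geometric_of_norm_lt_one (norm_exp_neg_two_mul_lt_one hz)

lemma summable_pnat_div_add_sq {a b : ℝ} (ha : 0 ≤ a) (hb : 0 < b) (z : ℂ) :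
    Summable fun n : ℕ+ ↦ z / ((a : ℂ) + b * (n : ℂ) ^ 2) := by
  have h : Summable fun n : ℕ+ ↦ ‖z‖ / b * (1 / (n : ℝ) ^ 2) :=
    summable_pnat_one_div_sq.mul_left _
  refine Summable.of_norm_bounded h fun n ↦ ?_
  have hn : (0 : ℝ) < n := by exact_mod_cast n.pos
  rw [show (a : ℂ) + b * (n : ℂ) ^ 2 = ((a + b * (n : ℝ) ^ 2 : ℝ) : ℂ) by push_cast; rfl, norm_div,
    Complex.norm_real, Real.norm_of_nonneg (by positivity), div_mul_div_comm, mul_one]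
  gcongr
  linarith

/-- The partial fraction expansion of `coth z`, in exponential form. -/
lemma one_add_two_mul_tsum_exp {z : ℝ} (hz : 0 < z) :
    1 + 2 * ∑' n : ℕ+, (Real.exp (-2 * z) : ℂ) ^ (n : ℕ) =
      1 / z + 2 * ∑' n : ℕ+, z / ((z ^ 2 : ℝ) + (π ^ 2 : ℝ) * (n : ℂ) ^ 2) := by
  have hpi : (π : ℂ) ≠ 0 := by exact_mod_cast Real.pi_ne_zero
  have hz0 : (z : ℂ) ≠ 0 := by exact_mod_cast hz.ne'
  -- At τ = iz/π the nome e^{2πiτ} is e^{-2z}, and the cotangent expansion becomes that of coth z.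
  let τ : UpperHalfPlane := ⟨Complex.I * (z / π : ℝ), by
    rw [Complex.I_mul_im, Complex.ofReal_re]
    exact div_pos hz Real.pi_pos⟩
  have hτ : (τ : ℂ) = Complex.I * (z / π : ℝ) := rfl
  have h1 := pi_mul_cot_pi_q_exp τ
  rw [cot_series_rep (UpperHalfPlane.coe_mem_integerComplement τ)] at h1
  have hexp : Complex.exp (2 * π * Complex.I * τ) = (Real.exp (-2 * z) : ℂ) := by
    rw [hτ, Complex.ofReal_exp]
    congr 1
    push_cast
    field_simp
    rw [Complex.I_sq]
  have h0 := tsum_zero_pnat_eq_tsum_nat (f := fun n : ℕ ↦ (Real.exp (-2 * z) : ℂ) ^ n)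
    (summable_exp_pow hz)
  rw [hexp, ← h0, pow_zero] at h1
  have hterm (n : ℕ+) : 1 / ((τ : ℂ) - n) + 1 / ((τ : ℂ) + n) =
      -2 * π * Complex.I * (z / ((z ^ 2 : ℝ) + (π ^ 2 : ℝ) * (n : ℂ) ^ 2)) := by
    have ha : (τ : ℂ) - n ≠ 0 := fun h ↦ τ.im_pos.ne' (by
      have := congrArg Complex.im h
      simpa using this)
    have hb : (τ : ℂ) + n ≠ 0 := fun h ↦ τ.im_pos.ne' (by
      have := congrArg Complex.im h
      simpa using this)
    have hd : (((z ^ 2 : ℝ) : ℂ) + (π ^ 2 : ℝ) * (n : ℂ) ^ 2) =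
        -π ^ 2 * (((τ : ℂ) - n) * ((τ : ℂ) + n)) := by
      rw [hτ]
      push_cast
      field_simp
      linear_combination ((z : ℂ) ^ 2) * Complex.I_sq
    rw [hd]
    have hz' : (z : ℂ) = -Complex.I * π * τ := by
      rw [hτ]
      push_cast
      field_simp
      rw [Complex.I_sq]
      ring
    rw [hz']
    field_simp
    linear_combination (2 * (τ : ℂ)) * Complex.I_sq
  simp_rw [hterm] at h1
  rw [tsum_mul_left, hτ] at h1
  push_cast at h1 ⊢
  generalize ∑' n : ℕ+, Complex.exp (-2 * z) ^ (n : ℕ) = A at *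
  generalize ∑' n : ℕ+, (z : ℂ) / ((z : ℂ) ^ 2 + (π : ℂ) ^ 2 * (n : ℂ) ^ 2) = B at *
  have h2 : 1 / (Complex.I * (z / π) : ℂ) = -π * Complex.I * (1 / z) := by
    field_simp
    rw [Complex.I_sq]
    ring
  rw [h2] at h1
  have h3 : (-π * Complex.I : ℂ) ≠ 0 := by simp [hpi]
  apply mul_left_cancel₀ h3
  linear_combination -h1

/-- Both sides equal (p/2) coth(pz) - (1/2) coth z: the poles at iπn/p with p ∣ n cancel, leaving
χ(n). -/
lemma half_sub_tsum_ramaCoeff_exp (p : ℕ) [hp : Fact p.Prime] {z : ℝ} (hz : 0 < z) :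
    ((p : ℂ) - 1) / 2 - ∑' e : ℕ+, ramaCoeff p e * (Real.exp (-2 * z) : ℂ) ^ (e : ℕ) =
      ∑' n : ℕ+, coprimeInd p n * (z / ((z ^ 2 : ℝ) + (π ^ 2 / p ^ 2 : ℝ) * (n : ℂ) ^ 2)) := by
  have hp0 : (0 : ℝ) < p := by exact_mod_cast hp.out.pos
  have hpC : (p : ℂ) ≠ 0 := by exact_mod_cast hp0.ne'
  have hpz : 0 < p * z := by positivity
  have hpi : (π : ℂ) ≠ 0 := by exact_mod_cast Real.pi_ne_zero
  have hgeom : Summable fun e : ℕ+ ↦ (Real.exp (-2 * z) : ℂ) ^ (e : ℕ) :=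
    (summable_exp_pow hz).comp_pnat_coe
  have hfrac : Summable fun n : ℕ+ ↦
      (z : ℂ) / ((z ^ 2 : ℝ) + (π ^ 2 / p ^ 2 : ℝ) * ((n : ℕ) : ℂ) ^ 2) :=
    summable_pnat_div_add_sq (sq_nonneg z) (by positivity) z
  have hA := hasSum_ramaCoeff_mul (p := p) (f := fun e ↦ (Real.exp (-2 * z) : ℂ) ^ e) hgeom
  have hB := hasSum_coprimeInd_mul hp.out.pos
    (f := fun n ↦ (z : ℂ) / ((z ^ 2 : ℝ) + (π ^ 2 / p ^ 2 : ℝ) * (n : ℂ) ^ 2)) hfrac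
  rw [hA.tsum_eq, hB.tsum_eq]
  have h1 := one_add_two_mul_tsum_exp hz
  have h2 := one_add_two_mul_tsum_exp hpz
  have e1 : ∑' n : ℕ+, (Real.exp (-2 * (p * z)) : ℂ) ^ (n : ℕ) =
      ∑' n : ℕ+, (Real.exp (-2 * z) : ℂ) ^ (p * n : ℕ) := by
    refine tsum_congr fun n ↦ ?_
    rw [pow_mul, ← Complex.ofReal_pow _ p, ← Real.exp_nat_mul]
    ring_nf
  have e2 : ∑' n : ℕ+, (z : ℂ) / ((z ^ 2 : ℝ) + (π ^ 2 / p ^ 2 : ℝ) * (n : ℂ) ^ 2) =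
      p * ∑' n : ℕ+, ((p * z : ℝ) : ℂ) / (((p * z) ^ 2 : ℝ) + (π ^ 2 : ℝ) * (n : ℂ) ^ 2) := by
    rw [← tsum_mul_left]
    refine tsum_congr fun n ↦ ?_
    have : (((p * z) ^ 2 : ℝ) : ℂ) + (π ^ 2 : ℝ) * (n : ℂ) ^ 2 =
        p ^ 2 * ((z ^ 2 : ℝ) + (π ^ 2 / p ^ 2 : ℝ) * (n : ℂ) ^ 2) := by
      push_cast
      field_simp
    rw [this, ← mul_div_assoc, Complex.ofReal_mul, Complex.ofReal_natCast, ← mul_assoc, ← sq,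
      mul_div_mul_left _ _ (pow_ne_zero 2 hpC)]
  have e3 : ∑' n : ℕ+, (z : ℂ) / ((z ^ 2 : ℝ) + (π ^ 2 / p ^ 2 : ℝ) * ((p * n : ℕ) : ℂ) ^ 2) =
      ∑' n : ℕ+, z / ((z ^ 2 : ℝ) + (π ^ 2 : ℝ) * (n : ℂ) ^ 2) := by
    refine tsum_congr fun n ↦ ?_
    congr 2
    push_cast
    field_simp
  rw [e1] at h2
  rw [e2, e3]
  have h4 : (p : ℂ) * (1 / ((p * z : ℝ) : ℂ)) = 1 / z := by
    push_cast
    field_simp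
  linear_combination (p : ℂ) / 2 * h2 - 1 / 2 * h1 + h4 / 2

lemma hasSum_coprimeInd_mul_inv_pow (p : ℕ) [hp : Fact p.Prime] {s : ℕ} (hs : 1 < s) :
    HasSum (fun n : ℕ+ ↦ coprimeInd p n * ((n : ℂ) ^ s)⁻¹)
      ((1 - ((p : ℂ) ^ s)⁻¹) * riemannZeta s) := by
  have hs0 : Summable fun n : ℕ ↦ ((n : ℂ) ^ s)⁻¹ := by
    rw [← summable_norm_iff]
    simpa using Real.summable_one_div_nat_pow.mpr hs
  have h0 := tsum_zero_pnat_eq_tsum_nat hs0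
  have h := hasSum_coprimeInd_mul hp.out.pos (f := fun n ↦ ((n : ℂ) ^ s)⁻¹)
    hs0.comp_pnat_coe
  convert! h using 1
  rw [zeta_nat_eq_tsum_of_gt_one hs]
  simp only [one_div]
  rw [← h0]
  simp only [Nat.cast_zero, zero_pow (by omega : s ≠ 0), inv_zero, zero_add, Nat.cast_mul,
    mul_pow, mul_inv, tsum_mul_left]
  ring

/-- The general term of the double series of partial fractions. -/
noncomputable def partialFractionTerm (p m : ℕ) (α β : ℝ) (d n : ℕ) : ℂ :=
  coprimeInd p d * coprimeInd p n * (((d : ℂ) ^ (2 * m))⁻¹ / (d ^ 2 * α + n ^ 2 * β))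

/-- Dropping d²α from the denominator and using m ≥ 1 bounds the terms by 1/(β d² n²). -/
lemma summable_partialFractionTerm (p : ℕ) {m : ℕ} (hm : 0 < m) {α β : ℝ} (hα : 0 < α)
    (hβ : 0 < β) :
    Summable fun c : ℕ+ × ℕ+ ↦ partialFractionTerm p m α β c.1 c.2 := by
  have h := summable_pnat_one_div_sq
  have hnonneg : 0 ≤ fun n : ℕ+ ↦ 1 / (n : ℝ) ^ 2 := fun n ↦ by positivity
  have h' := h.mul_of_nonneg h hnonneg hnonneg
  refine Summable.of_norm_bounded (h'.mul_left (1 / β)) fun c ↦ ?_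
  have h1 := norm_coprimeInd_le p c.1
  have h2 := norm_coprimeInd_le p c.2
  have hd : (1 : ℝ) ≤ c.1 := by exact_mod_cast c.1.pos
  have hn : (1 : ℝ) ≤ c.2 := by exact_mod_cast c.2.pos
  rw [partialFractionTerm, show ((c.1 : ℕ) : ℂ) ^ 2 * α + ((c.2 : ℕ) : ℂ) ^ 2 * β =
    (((c.1 : ℝ) ^ 2 * α + (c.2 : ℝ) ^ 2 * β : ℝ) : ℂ) by push_cast; rfl, norm_mul, norm_mul,
    norm_div, norm_inv, norm_pow, Complex.norm_natCast, Complex.norm_real,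
    Real.norm_of_nonneg (by positivity)]
  calc _ ≤ 1 * 1 * (((c.1 : ℝ) ^ 2)⁻¹ / ((c.2 : ℝ) ^ 2 * β)) := by
        gcongr
        · omega
        · have : 0 ≤ (c.1 : ℝ) ^ 2 * α := by positivity
          linarith
    _ = _ := by field_simp

lemma bracket_eq_tsum_partialFractionTerm (p : ℕ) [hp : Fact p.Prime] {α β : ℝ} (hα : 0 < α)
    (hβ : 0 < β) (hαβ : α * β = π ^ 2 / (p : ℝ) ^ 2) {m : ℕ} (hm : 0 < m) :
    ((p : ℂ) - 1) / 2 *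
        DirichletCharacter.LFunction (1 : DirichletCharacter ℂ p) ((2 * m + 1 : ℕ) : ℂ) -
      ∑' c : ℕ+ × ℕ+, lambertTerm p (-(2 * m + 1 : ℕ)) (Real.exp (-2 * α) : ℂ) c.1 c.2 =
    ∑' c : ℕ+ × ℕ+, partialFractionTerm p m α β c.1 c.2 := by
  have hr := norm_exp_neg_two_mul_lt_one hα
  have hL : DirichletCharacter.LFunction (1 : DirichletCharacter ℂ p) ((2 * m + 1 : ℕ) : ℂ) =
      (1 - ((p : ℂ) ^ (2 * m + 1))⁻¹) * riemannZeta (2 * m + 1 : ℕ) := by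
    rw [LFunction_trivChar_prime p (by norm_cast; omega), Complex.cpow_neg, Complex.cpow_natCast]
  have hZ := hasSum_coprimeInd_mul_inv_pow p (s := 2 * m + 1) (by omega)
  rw [← hL] at hZ
  have hs := summable_lambertTerm p (-(2 * m + 1 : ℕ)) hr
  -- The swap makes d the outer variable, so that the inner sum over e is the coth expansion at z =
  -- dα.
  rw [← (Equiv.prodComm ℕ+ ℕ+).tsum_eq]
  have hs' : Summable fun c : ℕ+ × ℕ+ ↦
      lambertTerm p (-(2 * m + 1 : ℕ)) (Real.exp (-2 * α) : ℂ) c.2 c.1 := hs.prod_symm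
  change _ - ∑' c : ℕ+ × ℕ+,
    lambertTerm p (-(2 * m + 1 : ℕ)) (Real.exp (-2 * α) : ℂ) c.2 c.1 = _
  rw [hs'.tsum_prod, (summable_partialFractionTerm p hm hα hβ).tsum_prod, ← hZ.tsum_eq,
    ← tsum_mul_left, ← (hZ.summable.mul_left _).tsum_sub hs'.prod]
  refine tsum_congr fun d ↦ ?_
  have hd : (0 : ℝ) < d := by exact_mod_cast d.pos
  have hdC : ((d : ℕ) : ℂ) ≠ 0 := by exact_mod_cast hd.ne'
  have hin : ∑' e : ℕ+, lambertTerm p (-(2 * m + 1 : ℕ)) (Real.exp (-2 * α) : ℂ) e d =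
      coprimeInd p d * ((d : ℂ) ^ (2 * m + 1))⁻¹ *
        ∑' e : ℕ+, ramaCoeff p e * (Real.exp (-2 * (d * α)) : ℂ) ^ (e : ℕ) := by
    rw [← tsum_mul_left]
    refine tsum_congr fun e ↦ ?_
    have : (Real.exp (-2 * (d * α)) : ℂ) = (Real.exp (-2 * α) : ℂ) ^ (d : ℕ) := by
      rw [← Complex.ofReal_pow, ← Real.exp_nat_mul]
      ring_nf
    rw [lambertTerm, this, ← pow_mul, zpow_neg, zpow_natCast, mul_comm (d : ℕ)]
    ring
  change _ - ∑' e : ℕ+, lambertTerm p (-(2 * m + 1 : ℕ)) (Real.exp (-2 * α) : ℂ) e d = _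
  rw [hin]
  have := half_sub_tsum_ramaCoeff_exp p (z := d * α) (by positivity)
  rw [mul_comm (((p : ℂ) - 1) / 2), ← mul_sub, this, ← tsum_mul_left]
  refine tsum_congr fun n ↦ ?_
  rw [partialFractionTerm, ← hαβ]
  have hαC : (α : ℂ) ≠ 0 := by exact_mod_cast hα.ne'
  have hden : ((((d : ℝ) * α) ^ 2 : ℝ) : ℂ) + (α * β : ℝ) * (n : ℂ) ^ 2 =
      α * (d ^ 2 * α + n ^ 2 * β) := by
    push_cast
    ring
  rw [hden, Complex.ofReal_mul, Complex.ofReal_natCast, mul_comm ((d : ℕ) : ℂ) (α : ℂ),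
    mul_div_mul_left _ _ hαC, pow_succ]
  field_simp

/-- Geometric sum in X⁻¹ and (-Y)⁻¹: their difference is (X + Y)/(XY), which cancels the denominator
and raises each exponent by one. -/
lemma partialFraction_identity {X Y : ℂ} (hX : X ≠ 0) (hY : Y ≠ 0) (hXY : X + Y ≠ 0) (m : ℕ) :
    (X⁻¹ ^ m - (-Y)⁻¹ ^ m) / (X + Y) =
      -∑ i ∈ range m, X⁻¹ ^ (i + 1) * (-Y)⁻¹ ^ (m - i) := by
  rw [← geom_sum₂_mul, mul_div_assoc]
  have : (X⁻¹ - (-Y)⁻¹) / (X + Y) = -(X⁻¹ * (-Y)⁻¹) := by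
    field_simp
    ring
  rw [this, sum_mul, ← sum_neg_distrib]
  refine sum_congr rfl fun i hi ↦ ?_
  have : m - i = m - 1 - i + 1 := by have := mem_range.mp hi; omega
  rw [this, pow_succ, pow_succ]
  ring

lemma tsum_partialFractionTerm_sub (p : ℕ) [hp : Fact p.Prime] {α β : ℝ} (hα : 0 < α)
    (hβ : 0 < β) {m : ℕ} (hm : 0 < m) :
    (α : ℂ)⁻¹ ^ m * ∑' c : ℕ+ × ℕ+, partialFractionTerm p m α β c.1 c.2 -
        (-(β : ℂ))⁻¹ ^ m * ∑' c : ℕ+ × ℕ+, partialFractionTerm p m β α c.1 c.2 =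
      -∑ i ∈ range m, (α : ℂ)⁻¹ ^ (i + 1) * (-(β : ℂ))⁻¹ ^ (m - i) *
        (((1 - ((p : ℂ) ^ (2 * (i + 1)))⁻¹) * riemannZeta (2 * (i + 1) : ℕ)) *
          ((1 - ((p : ℂ) ^ (2 * (m - i)))⁻¹) * riemannZeta (2 * (m - i) : ℕ))) := by
  rw [← (Equiv.prodComm ℕ+ ℕ+).tsum_eq (fun c : ℕ+ × ℕ+ ↦ partialFractionTerm p m β α c.1 c.2)]
  change _ - _ * ∑' c : ℕ+ × ℕ+, partialFractionTerm p m β α c.2 c.1 = _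
  have hA := summable_partialFractionTerm p hm hα hβ
  have hB : Summable fun c : ℕ+ × ℕ+ ↦ partialFractionTerm p m β α c.2 c.1 :=
    (summable_partialFractionTerm p hm hβ hα).prod_symm
  have hprod (i : ℕ) (hi : i ∈ range m) :
      HasSum (fun c : ℕ+ × ℕ+ ↦ (coprimeInd p c.1 * ((c.1 : ℂ) ^ (2 * (i + 1)))⁻¹) *
        (coprimeInd p c.2 * ((c.2 : ℂ) ^ (2 * (m - i)))⁻¹))
        (((1 - ((p : ℂ) ^ (2 * (i + 1)))⁻¹) * riemannZeta (2 * (i + 1) : ℕ)) *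
          ((1 - ((p : ℂ) ^ (2 * (m - i)))⁻¹) * riemannZeta (2 * (m - i) : ℕ))) := by
    have hi := mem_range.mp hi
    have h1 := hasSum_coprimeInd_mul_inv_pow p (s := 2 * (i + 1)) (by omega)
    have h2 := hasSum_coprimeInd_mul_inv_pow p (s := 2 * (m - i)) (by omega)
    have h3 := summable_mul_of_summable_norm h1.summable.norm h2.summable.norm
    have h4 := h1.mul h2 h3
    exact h4
  have hR := (hasSum_sum fun i hi ↦ (hprod i hi).mul_left
    ((α : ℂ)⁻¹ ^ (i + 1) * (-(β : ℂ))⁻¹ ^ (m - i))).neg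
  rw [← hR.tsum_eq, ← tsum_mul_left, ← tsum_mul_left,
    ← (hA.mul_left _).tsum_sub (hB.mul_left _)]
  refine tsum_congr fun c ↦ ?_
  have hd : (0 : ℝ) < c.1 := by exact_mod_cast c.1.pos
  have hn : (0 : ℝ) < c.2 := by exact_mod_cast c.2.pos
  have hX : ((c.1 : ℕ) : ℂ) ^ 2 * α ≠ 0 := by
    have : (c.1 : ℝ) ^ 2 * α ≠ 0 := by positivity
    exact_mod_cast this
  have hY : ((c.2 : ℕ) : ℂ) ^ 2 * β ≠ 0 := by
    have : (c.2 : ℝ) ^ 2 * β ≠ 0 := by positivity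
    exact_mod_cast this
  have hXY : ((c.1 : ℕ) : ℂ) ^ 2 * α + ((c.2 : ℕ) : ℂ) ^ 2 * β ≠ 0 := by
    have : (c.1 : ℝ) ^ 2 * α + (c.2 : ℝ) ^ 2 * β ≠ 0 := by positivity
    exact_mod_cast this
  have key := partialFraction_identity hX hY hXY m
  have hl : (α : ℂ)⁻¹ ^ m * partialFractionTerm p m α β c.1 c.2 -
      (-(β : ℂ))⁻¹ ^ m * partialFractionTerm p m β α c.2 c.1 =
      coprimeInd p c.1 * coprimeInd p c.2 *
        (((((c.1 : ℕ) : ℂ) ^ 2 * α)⁻¹ ^ m - (-(((c.2 : ℕ) : ℂ) ^ 2 * β))⁻¹ ^ m) /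
          (((c.1 : ℕ) : ℂ) ^ 2 * α + ((c.2 : ℕ) : ℂ) ^ 2 * β)) := by
    rw [partialFractionTerm, partialFractionTerm, add_comm (((c.2 : ℕ) : ℂ) ^ 2 * β),
      ← mul_neg, mul_inv, mul_inv, mul_pow, mul_pow, pow_mul, pow_mul, inv_pow (_ ^ 2),
      inv_pow (_ ^ 2)]
    ring
  rw [hl, key, mul_neg, mul_sum]
  congr 1
  refine sum_congr rfl fun i _ ↦ ?_
  rw [← mul_neg, mul_inv, mul_inv, mul_pow, mul_pow, pow_mul, pow_mul, inv_pow (_ ^ 2),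
    inv_pow (_ ^ 2)]
  ring

/-- Euler's formula with π² = p²αβ; the factor p^{2j} turns 1 - p^{-2j} into p^{2j} - 1. -/
lemma euler_zeta_even (p : ℕ) [hp : Fact p.Prime] {α β : ℝ}
    (hαβ : α * β = π ^ 2 / (p : ℝ) ^ 2) {j : ℕ} (hj : 0 < j) :
    (1 - ((p : ℂ) ^ (2 * j))⁻¹) * riemannZeta (2 * j : ℕ) =
      -(1 / 2) * (-4 * (α * β : ℂ)) ^ j * ((p : ℂ) ^ (2 * j) - 1) *
        ((bernoulli (2 * j) : ℂ) / ((2 * j).factorial : ℂ)) := by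
  have hpC : (p : ℂ) ≠ 0 := by exact_mod_cast hp.out.ne_zero
  have hab : (α * β : ℂ) = π ^ 2 / p ^ 2 := by exact_mod_cast hαβ
  rw [Nat.cast_mul, Nat.cast_ofNat, riemannZeta_two_mul_nat hj.ne', hab]
  have h2 : (2 : ℂ) ^ (2 * j - 1) = 4 ^ j / 2 := by
    rw [eq_div_iff two_ne_zero, ← pow_succ, show (4 : ℂ) = 2 ^ 2 by norm_num, ← pow_mul]
    congr 1
    omega
  have h4 : (-4 * ((π : ℂ) ^ 2 / p ^ 2)) ^ j = (-1) ^ j * 4 ^ j * π ^ (2 * j) / p ^ (2 * j) := by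
    rw [mul_pow, div_pow, pow_mul, pow_mul, neg_pow 4, mul_div_assoc]
  rw [h2, h4, pow_succ]
  have : (p : ℂ) ^ (2 * j) ≠ 0 := pow_ne_zero _ hpC
  field_simp

lemma bracket_transform_pos (p : ℕ) [hp : Fact p.Prime] {α β : ℝ} (hα : 0 < α) (hβ : 0 < β)
    (hαβ : α * β = π ^ 2 / (p : ℝ) ^ 2) {m : ℕ} (hm : 0 < m) :
    ((4 * (α : ℂ)) ^ m)⁻¹ *
        (((p : ℂ) - 1) / 2 *
            DirichletCharacter.LFunction (1 : DirichletCharacter ℂ p) ((2 * m + 1 : ℕ) : ℂ)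
          - ∑' c : ℕ+ × ℕ+, lambertTerm p (-(2 * m + 1 : ℕ)) (Real.exp (-2 * α) : ℂ) c.1 c.2) -
      ((-4 * (β : ℂ)) ^ m)⁻¹ *
        (((p : ℂ) - 1) / 2 *
            DirichletCharacter.LFunction (1 : DirichletCharacter ℂ p) ((2 * m + 1 : ℕ) : ℂ)
          - ∑' c : ℕ+ × ℕ+, lambertTerm p (-(2 * m + 1 : ℕ)) (Real.exp (-2 * β) : ℂ) c.1 c.2) =
      ∑ j ∈ Finset.Icc 1 m,
          (-1 : ℂ) ^ (j - 1) * ((p : ℂ) ^ (2 * j) - 1)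
            * ((p : ℂ) ^ (2 * m + 2 - 2 * j) - 1)
            * ((bernoulli (2 * j) : ℂ) / ((2 * j).factorial : ℂ))
            * ((bernoulli (2 * m + 2 - 2 * j) : ℂ)
                / ((2 * m + 2 - 2 * j).factorial : ℂ))
            * (α : ℂ) ^ (m + 1 - j) * (β : ℂ) ^ j := by
  have hαC : (α : ℂ) ≠ 0 := by exact_mod_cast hα.ne'
  have hβC : (β : ℂ) ≠ 0 := by exact_mod_cast hβ.ne'
  rw [bracket_eq_tsum_partialFractionTerm p hα hβ hαβ hm,
    bracket_eq_tsum_partialFractionTerm p hβ hα (by rw [mul_comm, hαβ]) hm]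
  have e1 : ((4 * (α : ℂ)) ^ m)⁻¹ = (4 ^ m)⁻¹ * (α : ℂ)⁻¹ ^ m := by
    rw [mul_pow, mul_inv, inv_pow]
  have e2 : ((-4 * (β : ℂ)) ^ m)⁻¹ = (4 ^ m)⁻¹ * (-(β : ℂ))⁻¹ ^ m := by
    rw [show -4 * (β : ℂ) = 4 * -β by ring, mul_pow, mul_inv, inv_pow]
  rw [e1, e2, mul_assoc, mul_assoc, ← mul_sub, tsum_partialFractionTerm_sub p hα hβ hm,
    mul_neg, mul_sum, ← sum_neg_distrib]
  refine sum_nbij (fun i ↦ i + 1) (by simp) (fun a _ b _ h ↦ by simpa using h)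
    (fun j hj ↦ ?_) fun i hi ↦ ?_
  · have := Finset.mem_Icc.mp hj
    exact ⟨j - 1, by simp; omega, by dsimp only; omega⟩
  · obtain ⟨l, rfl⟩ : ∃ l, m = i + 1 + l := ⟨m - i - 1, by have := mem_range.mp hi; omega⟩
    rw [show i + 1 + l - i = l + 1 by omega, show 2 * (i + 1 + l) + 2 - 2 * (i + 1) = 2 * (l + 1) by
      omega, show i + 1 + l + 1 - (i + 1) = l + 1 by omega, Nat.add_sub_cancel,
      euler_zeta_even p hαβ (by omega : 0 < i + 1),
      euler_zeta_even p hαβ (by omega : 0 < l + 1)]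
    have f1 : (α : ℂ)⁻¹ ^ (i + 1) * (-4 * (α * β : ℂ)) ^ (i + 1) = (-1) ^ (i + 1) * 4 ^ (i + 1) *
        β ^ (i + 1) := by
      rw [← mul_pow, ← mul_pow, ← mul_pow]
      congr 1
      field_simp
    have f2 : (-(β : ℂ))⁻¹ ^ (l + 1) * (-4 * (α * β : ℂ)) ^ (l + 1) = 4 ^ (l + 1) *
        α ^ (l + 1) := by
      rw [← mul_pow, ← mul_pow]
      congr 1
      field_simp
    -- The two zeta values carry m + 1 factors of 4 against 4^{-m}; the surplus 4 cancels the
    -- product of their factors -1/2.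
    have f3 : ((4 : ℂ) ^ (i + 1 + l))⁻¹ * (4 ^ (i + 1) * 4 ^ (l + 1)) = 4 := by
      rw [← pow_add, show i + 1 + (l + 1) = i + 1 + l + 1 by ring, pow_succ]
      field_simp
    generalize (bernoulli (2 * (i + 1)) : ℂ) / ((2 * (i + 1)).factorial : ℂ) = b1
    generalize (bernoulli (2 * (l + 1)) : ℂ) / ((2 * (l + 1)).factorial : ℂ) = b2
    generalize (p : ℂ) ^ (2 * (i + 1)) - 1 = P1
    generalize (p : ℂ) ^ (2 * (l + 1)) - 1 = P2
    calc _ = -(1 / 4) * ((4 : ℂ) ^ (i + 1 + l))⁻¹ *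
          ((α : ℂ)⁻¹ ^ (i + 1) * (-4 * (α * β : ℂ)) ^ (i + 1)) *
          ((-(β : ℂ))⁻¹ ^ (l + 1) * (-4 * (α * β : ℂ)) ^ (l + 1)) * P1 * P2 * b1 * b2 := by ring
      _ = -(1 / 4) * (((4 : ℂ) ^ (i + 1 + l))⁻¹ * (4 ^ (i + 1) * 4 ^ (l + 1))) *
          ((-1) ^ (i + 1) * β ^ (i + 1) * α ^ (l + 1)) * P1 * P2 * b1 * b2 := by
          rw [f1, f2]; ring
      _ = _ := by rw [f3, pow_succ (-1 : ℂ)]; ring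

end PositiveIndex

end

/-! ### Assembly according to the sign of k. -/

theorem theorem2p3 (p : ℕ) [Fact p.Prime] (α β : ℝ) (hα : 0 < α) (hβ : 0 < β)
    (hαβ : α * β = Real.pi ^ 2 / (p : ℝ) ^ 2) (k : ℤ) (hk : k ≠ 0) :
    Summable (fun n : ℕ+ => ramaTerm p k α n) ∧
    Summable (fun n : ℕ+ => ramaTerm p k β n) ∧
    (4 * (α : ℂ)) ^ (-k) *
        (((p : ℂ) - 1) / 2 *
            DirichletCharacter.LFunction (1 : DirichletCharacter ℂ p) (2 * (k : ℂ) + 1)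
          - ∑' n : ℕ+, ramaTerm p k α n)
      - (-4 * (β : ℂ)) ^ (-k) *
        (((p : ℂ) - 1) / 2 *
            DirichletCharacter.LFunction (1 : DirichletCharacter ℂ p) (2 * (k : ℂ) + 1)
          - ∑' n : ℕ+, ramaTerm p k β n)
      = ∑ j ∈ Finset.Icc 1 k.toNat,
          (-1 : ℂ) ^ (j - 1) * ((p : ℂ) ^ (2 * j) - 1)
            * ((p : ℂ) ^ (2 * k.toNat + 2 - 2 * j) - 1)
            * ((bernoulli (2 * j) : ℂ) / ((2 * j).factorial : ℂ))
            * ((bernoulli (2 * k.toNat + 2 - 2 * j) : ℂ)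
                / ((2 * k.toNat + 2 - 2 * j).factorial : ℂ))
            * (α : ℂ) ^ (k.toNat + 1 - j) * (β : ℂ) ^ j := by
  refine ⟨(hasSum_ramaTerm p k hα).summable, (hasSum_ramaTerm p k hβ).summable, ?_⟩
  rw [(hasSum_ramaTerm p k hα).tsum_eq, (hasSum_ramaTerm p k hβ).tsum_eq]
  obtain ⟨m, rfl | rfl⟩ := k.eq_nat_or_neg
  · have hm : 0 < m := by omega
    have hexp : -2 * (m : ℤ) - 1 = -((2 * m + 1 : ℕ) : ℤ) := by push_cast; ring
    have hs : 2 * ((m : ℤ) : ℂ) + 1 = ((2 * m + 1 : ℕ) : ℂ) := by push_cast; ring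
    rw [hexp, hs, Int.toNat_natCast, zpow_neg, zpow_neg, zpow_natCast, zpow_natCast]
    exact bracket_transform_pos p hα hβ hαβ hm
  · have hm : 0 < m := by omega
    have hexp : -2 * (-(m : ℤ)) - 1 = ((2 * m - 1 : ℕ) : ℤ) := by omega
    have hs : 2 * ((-(m : ℤ) : ℤ) : ℂ) + 1 = 1 - ((2 * m : ℕ) : ℂ) := by push_cast; ring
    -- For negative k, `k.toNat` is 0 and the Bernoulli sum is empty.
    rw [hexp, hs, neg_neg, zpow_natCast, zpow_natCast, bracket_transform_neg p hα hβ hαβ hm,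
      sub_self, Int.toNat_neg_natCast]
    rfl
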